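/- Let $d\ge 1$, $N_1,\dots,N_d\ge 1$ and $N_D=\prod_{i=1}^d N_i$. For $i=1,\dots,d$ let $f_{L,i},f_{H,i}\in[0,1)$ with $f_{L,i}\ne f_{H,i}$, and let $\mathbb F_i=[f_{L,i},f_{H,i}]$ if $f_{L,i}<f_{H,i}$ and $\mathbb F_i=[0,1)\setminus(f_{H,i},f_{L,i})$ if $f_{L,i}>f_{H,i}$. Put $\boldsymbol s_i(f)=[1,e^{i2\pi f},\dots,e^{i2\pi(N_i-1)f}]^T$ and $\boldsymbol a(f_1,\dots,f_d)=\boldsymbol s_1(f_1)\otimes\cdots\otimes\boldsymbol s_d(f_d)\in\mathbb C^{N_D}$. The frequency-selective atomic norm of $\boldsymbol x\in\mathbb C^{N_D}$ is $$\|\boldsymbol x\|_{\mathcal A(\mathbb F)}=\inf\Big\{\sum_{\ell}|\sigma_\ell| : \boldsymbol x=\sum_{\ell}\sigma_\ell\,\boldsymbol a(f_{1,\ell},\dots,f_{d,\ell})\ \text{(finite sum)},\ \sigma_\ell\in\mathbb C,\ f_{i,\ell}\in\mathbb F_i\Big\}.$$ For a $d$-way tensor $\mathcal B\in\mathbb C^{(2N_1-1)\times\cdots\times(2N_d-1)}$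 whose $i$-th index runs over $-(N_i-1),\dots,N_i-1$, let $\boldsymbol T^d(\mathcal B)$ be the $N_D\times N_D$ $d$-level block Toeplitz matrix whose entry with row multi-index $(m_1,\dots,m_d)$ and column multi-index $(n_1,\dots,n_d)$, $1\le m_j,n_j\le N_j$, is $\mathcal B(m_1-n_1,\dots,m_d-n_d)$. For each $i$ put $r_{0,i}=-2\cos[\pi(f_{H,i}-f_{L,i})]\,\mathrm{sign}(f_{H,i}-f_{L,i})$, $r_{1,i}=e^{i\pi(f_{L,i}+f_{H,i})}\,\mathrm{sign}(f_{H,i}-f_{L,i})$, $r_{-1,i}=\overline{r_{1,i}}$, and let $\boldsymbol T^d_{g_i}(\mathcal B)$ be the $\prod_j(N_j-1)\times\prod_j(N_j-1)$ matrix with entries $$\sum_{k=-1}^{1}r_{k,i}\,\mathcal B(m_1-n_1,\dots,m_i-n_i-k,\dots,m_d-n_d),\qquad 1\le m_j,n_j\le N_j-1.$$ For every $\boldsymbol x\in\mathbb C^{N_D}$, the infimum defining $\|\boldsymbol x\|_{\mathcal A(\mathbb F)}$ is over a nonempty set, the minimum below is attained, and $$\|\boldsymbol x\|_{\mathcal A(\mathbb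 F)}\ \ge\ \min_{\mathcal B,\,t\in\mathbb R}\ \frac1{2N_D}\mathrm{Tr}(\boldsymbol T^d(\mathcal B))+\frac12 t\quad\text{s.t.}\quad\begin{bmatrix}\boldsymbol T^d(\mathcal B)&\boldsymbol x\\ \boldsymbol x^H&t\end{bmatrix}\succeq 0,\quad \boldsymbol T^d_{g_i}(\mathcal B)\succeq 0,\ i=1,\dots,d.$$ Moreover, if some minimizer $(\mathcal B,t)$ satisfies $\mathrm{rank}\,\boldsymbol T^d(\mathcal B)<\min_i N_i$, then equality holds. -/

import Mathlib

open scoped ComplexOrder Matrix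

namespace MDFS

noncomputable section

/-- Index set of the entries of a vector of `ℂ^(N_1 ⋯ N_d)` viewed as an iterated Kronecker product:
multi-indices `(k_1, …, k_d)` with `0 ≤ k_i < N_i`. -/
abbrev Idx {d : ℕ} (N : Fin d → ℕ) : Type := (i : Fin d) → Fin (N i)

/-- Frequency band in `[0, 1)`: the closed interval `[fL, fH]` if `fL < fH`, and the wrapped-around
band `[0, 1) ∖ (fH, fL)` if `fL > fH`. (The case `fL = fH` is never used.) -/
def band (fL fH : ℝ) : Set ℝ :=
  if fL < fH then Set.Icc fL fH else Set.Ico 0 1 \ Set.Ioo fH fL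

/-- The complex sinusoid `s_n(f) = (1, e^{i2πf}, …, e^{i2π(n-1)f})`. -/
def sinusoid (n : ℕ) (f : ℝ) : Fin n → ℂ :=
  fun k => Complex.exp (2 * Real.pi * Complex.I * ((k : ℕ) : ℂ) * (f : ℂ))

/-- The atom `a(f) = s_1(f_1) ⊗ ⋯ ⊗ s_d(f_d)`. -/
def atom {d : ℕ} (N : Fin d → ℕ) (f : Fin d → ℝ) : Idx N → ℂ :=
  fun k => ∏ i, sinusoid (N i) (f i) (k i)

/-- The total weights `∑ |σ_ℓ|` of all finite decompositions `x = ∑ σ_ℓ a(f_ℓ)`, `σ_ℓ ∈ ℂ`, whose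
frequencies lie in the prescribed bands. -/
def decompositionCosts {d : ℕ} (N : Fin d → ℕ) (fL fH : Fin d → ℝ) (x : Idx N → ℂ) : Set ℝ :=
  {c | ∃ (r : ℕ) (f : Fin r → Fin d → ℝ) (σ : Fin r → ℂ),
    (∀ l i, f l i ∈ band (fL i) (fH i)) ∧
    x = ∑ l, σ l • atom N (f l) ∧
    c = ∑ l, ‖σ l‖}

/-- The frequency-selective atomic norm of `x`. -/
def atomicNorm {d : ℕ} (N : Fin d → ℕ) (fL fH : Fin d → ℝ) (x : Idx N → ℂ) : ℝ :=
  sInf (decompositionCosts N fL fH x)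

/-- `d`-way tensors of size `(2N_1-1) × ⋯ × (2N_d-1)`, with the `i`-th index running over
`-(N_i-1), …, N_i-1`. -/
abbrev Tensor {d : ℕ} (N : Fin d → ℕ) : Type :=
  ((i : Fin d) → {k : ℤ // |k| < (N i : ℤ)}) → ℂ

/-- The entry of a tensor at an integer multi-index. (The value `0` outside the index range is never
used by the matrices below.) -/
def Tensor.entry {d : ℕ} {N : Fin d → ℕ} (B : Tensor N) (k : Fin d → ℤ) : ℂ :=
  if h : ∀ i, |k i| < (N i : ℤ) then B (fun i => ⟨k i, h i⟩) else 0

/-- The difference `m - n` of two multi-indices. -/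
def lag {d : ℕ} {N : Fin d → ℕ} (m n : Idx N) : Fin d → ℤ :=
  fun i => ((m i : ℕ) : ℤ) - ((n i : ℕ) : ℤ)

/-- The `d`-level block Toeplitz matrix `T^d(B)`, with `(m, n)` entry `B(m_1-n_1, …, m_d-n_d)`. -/
def toeplitz {d : ℕ} {N : Fin d → ℕ} (B : Tensor N) : Matrix (Idx N) (Idx N) ℂ :=
  Matrix.of fun m n => B.entry (lag m n)

/-- The coefficient `r_0` of the trigonometric polynomial `g = r_1 z⁻¹ + r_0 + r_{-1} z` of a band. -/
def coeff0 (fL fH : ℝ) : ℝ :=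
  -2 * Real.cos (Real.pi * (fH - fL)) * Real.sign (fH - fL)

/-- The coefficient `r_1` of `g`; the coefficient `r_{-1}` is its complex conjugate. -/
def coeff1 (fL fH : ℝ) : ℂ :=
  Complex.exp (Complex.I * Real.pi * ((fL : ℂ) + (fH : ℂ))) * (Real.sign (fH - fL) : ℂ)

/-- The `d`-level block Toeplitz matrix `T^d_{g_i}(B)` of order `(N_1-1) ⋯ (N_d-1)`, with `(m, n)`
entry `∑_{k=-1}^{1} r_{k,i} B(m_1-n_1, …, m_i-n_i-k, …, m_d-n_d)`. -/
def toeplitzG {d : ℕ} {N : Fin d → ℕ} (fL fH : Fin d → ℝ) (i : Fin d) (B : Tensor N) :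
    Matrix (Idx fun j => N j - 1) (Idx fun j => N j - 1) ℂ :=
  Matrix.of fun m n =>
    coeff1 (fL i) (fH i) * B.entry (lag m n - Pi.single i 1)
      + (coeff0 (fL i) (fH i) : ℂ) * B.entry (lag m n)
      + star (coeff1 (fL i) (fH i)) * B.entry (lag m n + Pi.single i 1)

/-- The bordered matrix `[[T^d(B), x], [x^H, t]]`. -/
def bordered {d : ℕ} {N : Fin d → ℕ} (B : Tensor N) (x : Idx N → ℂ) (t : ℝ) :
    Matrix (Idx N ⊕ Unit) (Idx N ⊕ Unit) ℂ :=
  Matrix.fromBlocks (toeplitz B) (Matrix.replicateCol Unit x)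
    (Matrix.replicateCol Unit x)ᴴ (Matrix.of fun _ _ => (t : ℂ))

/-- The constraints of the semidefinite program. -/
def Feasible {d : ℕ} {N : Fin d → ℕ} (fL fH : Fin d → ℝ) (x : Idx N → ℂ)
    (B : Tensor N) (t : ℝ) : Prop :=
  (bordered B x t).PosSemidef ∧ ∀ i, (toeplitzG fL fH i B).PosSemidef

/-- The objective `Tr(T^d(B)) / (2 N_D) + t / 2`, `N_D = N_1 ⋯ N_d`. (At feasible points the trace
is real, because `T^d(B)` is Hermitian.) -/
def objective {d : ℕ} {N : Fin d → ℕ} (B : Tensor N) (t : ℝ) : ℝ :=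
  1 / (2 * ((∏ i, N i : ℕ) : ℝ)) * (toeplitz B).trace.re + 1 / 2 * t

/-- The values of the objective on the feasible set of the semidefinite program. -/
def sdpValues {d : ℕ} (N : Fin d → ℕ) (fL fH : Fin d → ℝ) (x : Idx N → ℂ) : Set ℝ :=
  {v | ∃ (B : Tensor N) (t : ℝ), Feasible fL fH x B t ∧ v = objective B t}

end

end MDFS

/-!
The lower bound holds because a decomposition `x = ∑ σ_l a(f_l)` yields the feasible point
`B = ∑ |σ_l| e^{i2π⟨k, f_l⟩}`, `t = ∑ |σ_l|`, whose objective is the cost of the decomposition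
(`decompositionCosts_subset_sdpValues`). Feasibility of the matrices `T^d_{g_i}` comes from the
factorization `g = -4 sign(f_H - f_L) sin(π(f - f_L)) sin(π(f - f_H))`, which shows that on `[0, 1)`
the polynomial `g` is nonnegative exactly on the band (`zero_le_bandPoly_iff`). Decompositions exist
because a band is infinite and Vandermonde matrices of distinct nodes are invertible. The minimum is
attained because the entries of a positive semidefinite Toeplitz matrix are dominated by its diagonal,
so sublevel sets are compact (`exists_isLeast_sdpValues`).

For the equality, let `T^d(B)` have rank `r < min N_i` and write it as the Gram matrix of vectors
`y_m` spanning a space of dimension `r`. The Toeplitz structure says that raising the `i`-th index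
preserves inner products. Since `r < N_i`, a dimension count shows that the `y_m` with all
`m_i < N_i - 1` already span (`ShiftInvariant.span_box_sub_one`), so the index shifts extend to
commuting unitaries of the whole space. Decomposing `y_0` into joint eigenvectors gives
`y_m = ∑ z_l^m v_l` with orthogonal `v_l` (`ShiftInvariant.exists_eq_sum_pow`), hence
`T^d(B) = ∑ c_l a(f_l) a(f_l)^H` with `c_l = ‖v_l‖² > 0` (`exists_eq_spectralTensor`). Writing each
`v_l` as a combination of the `y_m` produces vectors dual to the atoms, both at size `N` and at size
`N - 1`. Testing `T^d_{g_i}(B)` against the latter gives `g_i(f_{l,i}) ≥ 0`, so the frequencies lie in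
the bands; testing the bordered matrix against combinations of the former shows that `x` is a
combination `∑ σ_l a(f_l)` with `2 ∑ |σ_l| ≤ ∑ c_l + t`, twice the objective
(`Feasible.exists_cost_le`).
-/

namespace MDFS

open Module

/-! ### Families of vectors with a shift-invariant Gram matrix -/

section ShiftInvariant

variable {E : Type*} [NormedAddCommGroup E] [InnerProductSpace ℂ E]

/-- Families with equal Gram matrices satisfy the same linear relations, so a linear map carries one
to the other. -/
theorem exists_linearMap_of_inner_eq {ι : Type*} (u w : ι → E)
    (h : ∀ a b, inner ℂ (u a) (u b) = inner ℂ (w a) (w b)) :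
    ∃ U : E →ₗ[ℂ] E, ∀ a, U (u a) = w a := by
  set F := Finsupp.linearCombination ℂ u
  set G := Finsupp.linearCombination ℂ w
  have hFG : ∀ c, inner ℂ (F c) (F c) = inner ℂ (G c) (G c) := fun c => by
    simp only [F, G, Finsupp.linearCombination_apply, Finsupp.sum_inner, Finsupp.inner_sum, h,
      inner_smul_left, inner_smul_right]
  have hker : ∀ c, F c = 0 → G c = 0 := fun c hc => by
    have := hFG c
    rw [hc, inner_zero_left] at this
    exact inner_self_eq_zero.1 this.symm
  obtain ⟨s, hs⟩ := F.rangeRestrict.exists_rightInverse_of_surjective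
    (LinearMap.range_rangeRestrict F)
  obtain ⟨U, hU⟩ := (G ∘ₗ s).exists_extend
  refine ⟨U, fun a => ?_⟩
  have h1 : F (Finsupp.single a 1) = u a := by simp [F]
  have h2 : G (Finsupp.single a 1) = w a := by simp [G]
  have h3 := LinearMap.congr_fun hU (F.rangeRestrict (Finsupp.single a 1))
  have h4 := hker (s (F.rangeRestrict (Finsupp.single a 1)) - Finsupp.single a 1) (by
    have := congrArg Subtype.val (LinearMap.congr_fun hs (F.rangeRestrict (Finsupp.single a 1)))
    simp only [LinearMap.comp_apply, LinearMap.id_apply, LinearMap.codRestrict_apply,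
      LinearMap.rangeRestrict] at this
    rw [map_sub]
    exact sub_eq_zero.2 this)
  rw [map_sub, sub_eq_zero] at h4
  rw [← h1, ← h2, ← h4]
  exact h3

variable {d : ℕ}

/-- The multi-indices `m` with `0 ≤ m_i < M_i`, as a set of functions into `ℕ`. -/
def box (M : Fin d → ℕ) : Set (Fin d → ℕ) := {m | ∀ i, m i < M i}

theorem box_mono {M N : Fin d → ℕ} (h : M ≤ N) : box M ⊆ box N :=
  fun _ hm i => (hm i).trans_le (h i)

theorem add_single_mem_box {M N : Fin d → ℕ} {m : Fin d → ℕ} {i : Fin d} (hm : m ∈ box M)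
    (h : ∀ j, M j ≤ N j) (hi : M i + 1 ≤ N i) : m + Pi.single i 1 ∈ box N := by
  intro j
  by_cases hj : j = i
  · subst hj
    have := hm j
    simp only [Pi.add_apply, Pi.single_eq_same]
    omega
  · simpa [hj] using (hm j).trans_le (h j)

/-- A family of vectors indexed by the box of size `N` is shift invariant if its inner products do
not change when both indices are raised by one in the same direction, as long as they stay in the
box. Its Gram matrix is then `d`-level block Toeplitz. -/
def ShiftInvariant (N : Fin d → ℕ) (y : (Fin d → ℕ) → E) : Prop :=
  ∀ i m n, m + Pi.single i 1 ∈ box N → n + Pi.single i 1 ∈ box N →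
    inner ℂ (y m) (y n) = inner ℂ (y (m + Pi.single i 1)) (y (n + Pi.single i 1))

theorem ShiftInvariant.exists_shift {N : Fin d → ℕ} {y : (Fin d → ℕ) → E}
    (hy : ShiftInvariant N y) (i : Fin d) :
    ∃ U : E →ₗ[ℂ] E, ∀ m, m + Pi.single i 1 ∈ box N → U (y m) = y (m + Pi.single i 1) := by
  obtain ⟨U, hU⟩ := exists_linearMap_of_inner_eq
    (fun m : {m : Fin d → ℕ // m + Pi.single i 1 ∈ box N} => y m.1)
    (fun m => y (m.1 + Pi.single i 1)) (fun a b => hy i a b a.2 b.2)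
  exact ⟨U, fun m hm => hU ⟨m, hm⟩⟩

/-- Slicing the box in direction `i` gives a chain of spans. Since the shift carries slice `k` to
slice `k + 1`, the chain is constant once it stops growing, so it has stabilised after at most
`finrank ℂ E < M i` steps and the last slice adds nothing. -/
theorem ShiftInvariant.span_box_eq_top [FiniteDimensional ℂ E] {N M : Fin d → ℕ}
    {y : (Fin d → ℕ) → E} (hy : ShiftInvariant N y) (hMN : M ≤ N)
    (hM : Submodule.span ℂ (y '' box M) = ⊤) (i : Fin d) (hi : finrank ℂ E < M i) :
    Submodule.span ℂ (y '' box (Function.update M i (M i - 1))) = ⊤ := by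
  obtain ⟨U, hU⟩ := hy.exists_shift i
  set V : ℕ → Submodule ℂ E := fun k => Submodule.span ℂ (y '' box (Function.update M i k)) with hV
  have mono : Monotone V := fun a b hab => Submodule.span_mono
    (Set.image_mono (box_mono (update_le_update_iff.2 ⟨hab, fun _ _ => le_rfl⟩)))
  have htop : V (M i) = ⊤ := by simp only [hV, Function.update_eq_self, hM]
  have step : ∀ k, k + 2 ≤ M i → V k = V (k + 1) → V (k + 1) = V (k + 2) := by
    intro k hk hkk
    refine le_antisymm (mono (by omega)) (Submodule.span_le.2 ?_)
    have hmap : (V k).map U ≤ V (k + 1) := by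
      rw [Submodule.map_span_le]
      rintro _ ⟨m, hm, rfl⟩
      have hm' : m + Pi.single i 1 ∈ box (Function.update M i (k + 1)) := by
        refine add_single_mem_box hm (fun j => ?_) (by simp)
        by_cases hj : j = i
        · subst hj; simp
        · simp [hj]
      rw [hU m (box_mono (fun j => ?_) hm')]
      · exact Submodule.subset_span ⟨_, hm', rfl⟩
      · by_cases hj : j = i
        · subst hj; have h2 : M j ≤ N j := hMN j; simp; omega
        · simpa [hj] using hMN j
    rintro _ ⟨m, hm, rfl⟩
    by_cases h0 : m i = 0
    · refine Submodule.subset_span ⟨m, fun j => ?_, rfl⟩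
      by_cases hj : j = i
      · subst hj; simp [h0]
      · simpa [hj] using hm j
    · have hm1 : m - Pi.single i 1 + Pi.single i 1 = m := by
        ext j
        by_cases hj : j = i
        · subst hj; simp; omega
        · simp [hj]
      have hmN : m ∈ box N := fun j => by
        have h1 := hm j
        have h2 : M j ≤ N j := hMN j
        by_cases hj : j = i
        · subst hj; simp at h1; omega
        · simp [hj] at h1; omega
      have hm2 : y (m - Pi.single i 1) ∈ V k := by
        rw [hkk]
        refine Submodule.subset_span ⟨_, fun j => ?_, rfl⟩
        have h1 := hm j
        by_cases hj : j = i
        · subst hj; simp at h1 ⊢; omega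
        · simpa [hj] using h1
      have := hmap (Submodule.mem_map_of_mem hm2)
      rwa [hU _ (by rwa [hm1]), hm1] at this
  by_contra hne
  have strict : ∀ k, k < M i → V k ≠ V (k + 1) := by
    intro k hk heq
    have : ∀ j, k + j < M i → V (k + j) = V (k + j + 1) := by
      intro j
      induction j with
      | zero => exact fun _ => heq
      | succ j ih => exact fun hj => step (k + j) (by omega) (ih (by omega))
    have h1 := this (M i - 1 - k) (by omega)
    rw [show k + (M i - 1 - k) = M i - 1 by omega, show M i - 1 + 1 = M i by omega, htop] at h1
    exact hne h1
  have hdim : ∀ k, k ≤ M i → k ≤ finrank ℂ (V k) := by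
    intro k
    induction k with
    | zero => exact fun _ => Nat.zero_le _
    | succ k ih =>
      intro hk
      exact (ih (by omega)).trans_lt (Submodule.finrank_lt_finrank_of_lt
        (lt_of_le_of_ne (mono (by omega)) (strict k (by omega))))
  have := hdim _ le_rfl
  rw [htop, finrank_top] at this
  omega

/-- The directions are shortened one at a time; the span stays the whole space, so the dimension
bound stays available for the next direction. -/
theorem ShiftInvariant.span_box_sub_one [FiniteDimensional ℂ E] {N : Fin d → ℕ}
    {y : (Fin d → ℕ) → E} (hy : ShiftInvariant N y)
    (hN : Submodule.span ℂ (y '' box N) = ⊤) (hr : ∀ i, finrank ℂ E < N i) :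
    Submodule.span ℂ (y '' box (fun i => N i - 1)) = ⊤ := by
  classical
  suffices h : ∀ s : Finset (Fin d),
      Submodule.span ℂ (y '' box (fun i => if i ∈ s then N i - 1 else N i)) = ⊤ by
    simpa using h Finset.univ
  intro s
  induction s using Finset.induction_on with
  | empty => simpa using hN
  | insert i s his ih =>
    have := hy.span_box_eq_top (fun j => by dsimp only; split_ifs <;> omega) ih i
      (by simpa [his] using hr i)
    convert this using 4
    ext j
    by_cases hj : j = i
    · subst hj; simp [his]
    · simp [hj]

/-- Commuting unitaries on a finite-dimensional space are simultaneously diagonalizable: every vector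
is a sum of orthogonal joint eigenvectors. -/
theorem exists_orthogonal_joint_eigenvectors [FiniteDimensional ℂ E] {κ : Type} (U : κ → E →ₗ[ℂ] E)
    (hU : ∀ i x y, inner ℂ (U i x) (U i y) = inner ℂ x y)
    (hc : ∀ i j, Commute (U i) (U j)) (x : E) :
    ∃ (ι : Type) (_ : Fintype ι) (z : ι → κ → ℂ) (v : ι → E),
      (∀ l i, U i (v l) = z l i • v l) ∧ (∀ l i, ‖z l i‖ = 1) ∧ (∀ l, v l ≠ 0) ∧
      (∀ l k, l ≠ k → inner ℂ (v l) (v k) = 0) ∧ x = ∑ l, v l := by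
  classical
  have adjU : ∀ i, LinearMap.adjoint (U i) * U i = 1 := fun i => by
    refine LinearMap.ext fun a => ext_inner_right ℂ fun b => ?_
    rw [Module.End.mul_apply, LinearMap.adjoint_inner_left, hU]; rfl
  have Uadj : ∀ i, U i * LinearMap.adjoint (U i) = 1 := fun i =>
    mul_eq_one_comm.1 (adjU i)
  have hc' : ∀ i j, Commute (U i) (LinearMap.adjoint (U j)) := fun i j =>
    calc U i * LinearMap.adjoint (U j)
        = (LinearMap.adjoint (U j) * U j) * U i * LinearMap.adjoint (U j) := by
          rw [adjU, one_mul]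
      _ = LinearMap.adjoint (U j) * (U i * U j) * LinearMap.adjoint (U j) := by
          rw [(hc i j).eq]; simp only [mul_assoc]
      _ = LinearMap.adjoint (U j) * U i := by
          simp only [mul_assoc, Uadj, mul_one]
  have hc'' : ∀ i j, Commute (LinearMap.adjoint (U i)) (LinearMap.adjoint (U j)) := fun i j => by
    have := congrArg LinearMap.adjoint (hc j i).eq
    simp only [← LinearMap.star_eq_adjoint, star_mul] at this ⊢
    exact this
  -- the real and imaginary parts of the `U i`, up to scalars
  set T : κ × Bool → E →ₗ[ℂ] E := fun p =>
    if p.2 then U p.1 + LinearMap.adjoint (U p.1)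
    else Complex.I • (U p.1 - LinearMap.adjoint (U p.1)) with hT
  have hsymm : ∀ p, (T p).IsSymmetric := by
    rintro ⟨i, b⟩
    rw [LinearMap.isSymmetric_iff_isSelfAdjoint, IsSelfAdjoint]
    cases b
    · simp only [hT, Bool.false_eq_true, if_false, star_smul, star_sub,
        LinearMap.star_eq_adjoint, LinearMap.adjoint_adjoint]
      rw [show star Complex.I = -Complex.I from Complex.conj_I, neg_smul, ← smul_neg, neg_sub]
    · simp only [hT, if_true, star_add, LinearMap.star_eq_adjoint, LinearMap.adjoint_adjoint]
      exact add_comm _ _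
  have hcomm : Pairwise (Function.onFun Commute T) := by
    rintro ⟨i, b⟩ ⟨j, b'⟩ -
    have h1 := hc i j
    have h2 := hc' i j
    have h3 := (hc' j i).symm
    have h4 := hc'' i j
    cases b <;> cases b' <;> simp only [Function.onFun, hT, Bool.false_eq_true, if_false, if_true]
    · exact (((h1.sub_right h2).sub_left (h3.sub_right h4)).smul_left _).smul_right _
    · exact ((h1.add_right h2).sub_left (h3.add_right h4)).smul_left _
    · exact ((h1.sub_right h2).add_left (h3.sub_right h4)).smul_right _
    · exact (h1.add_right h2).add_left (h3.add_right h4)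
  have hmem : x ∈ ⨆ χ : κ × Bool → ℂ, ⨅ p, End.eigenspace (T p) (χ p) := by
    rw [LinearMap.IsSymmetric.iSup_iInf_eq_top_of_commute hsymm hcomm]; trivial
  obtain ⟨f, hf, hx⟩ := (Submodule.mem_iSup_iff_exists_finsupp _ _).1 hmem
  have heig : ∀ χ i, U i (f χ) = ((χ (i, true) - Complex.I * χ (i, false)) / 2) • f χ := by
    intro χ i
    have h1 := End.mem_eigenspace_iff.1 ((Submodule.mem_iInf _).1 (hf χ) (i, true))
    have h2 := End.mem_eigenspace_iff.1 ((Submodule.mem_iInf _).1 (hf χ) (i, false))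
    simp only [hT, if_true, Bool.false_eq_true, if_false, LinearMap.add_apply, LinearMap.smul_apply,
      LinearMap.sub_apply] at h1 h2
    have h3 : (2 : ℂ) • U i (f χ) = (χ (i, true) - Complex.I * χ (i, false)) • f χ := by
      rw [sub_smul, mul_smul, ← h1, ← h2, smul_smul, Complex.I_mul_I]
      module
    rw [div_eq_inv_mul, mul_smul, ← h3, smul_smul]
    norm_num
  refine ⟨f.support, inferInstance,
    fun χ i => (χ.1 (i, true) - Complex.I * χ.1 (i, false)) / 2, fun χ => f χ, fun χ i => heig _ _,
    fun χ i => ?_, fun χ => Finsupp.mem_support_iff.1 χ.2, fun χ ψ hne => ?_, ?_⟩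
  · have h0 : f χ ≠ 0 := Finsupp.mem_support_iff.1 χ.2
    have h1 : ‖U i (f χ)‖ = ‖f χ‖ := by
      rw [@norm_eq_sqrt_re_inner ℂ, hU, ← @norm_eq_sqrt_re_inner ℂ]
    rw [heig, norm_smul] at h1
    exact mul_right_cancel₀ (norm_ne_zero_iff.2 h0) (h1.trans (one_mul _).symm)
  · have := (LinearMap.IsSymmetric.orthogonalFamily_iInf_eigenspaces hsymm)
      (fun h => hne (Subtype.ext h)) ⟨f χ, hf χ⟩ ⟨f ψ, hf ψ⟩
    simpa using this
  · rw [← hx, Finsupp.sum, ← Finset.sum_coe_sort]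

/-- A shift-invariant family of small rank is a superposition of orthogonal multi-dimensional
geometric progressions with ratios on the unit circle. -/
theorem ShiftInvariant.exists_eq_sum_pow [FiniteDimensional ℂ E] {N : Fin d → ℕ}
    {y : (Fin d → ℕ) → E} (hy : ShiftInvariant N y)
    (hN : Submodule.span ℂ (y '' box N) = ⊤) (hr : ∀ i, finrank ℂ E < N i) :
    ∃ (ι : Type) (_ : Fintype ι) (z : ι → Fin d → ℂ) (v : ι → E),
      (∀ l i, ‖z l i‖ = 1) ∧ (∀ l, v l ≠ 0) ∧ (∀ l k, l ≠ k → inner ℂ (v l) (v k) = 0) ∧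
      ∀ m ∈ box N, y m = ∑ l, (∏ i, z l i ^ m i) • v l := by
  choose U hU using fun i => hy.exists_shift i
  have hspan := hy.span_box_sub_one hN hr
  have hadd : ∀ i, ∀ m ∈ box (fun i => N i - 1), m + Pi.single i 1 ∈ box N := fun i m hm =>
    add_single_mem_box hm (fun j => Nat.sub_le _ _) (by have := hr i; omega)
  have hiso : ∀ i a b, inner ℂ (U i a) (U i b) = inner ℂ a b := by
    intro i a b
    have ha : a ∈ Submodule.span ℂ (y '' box (fun i => N i - 1)) := hspan ▸ Submodule.mem_top
    have hb : b ∈ Submodule.span ℂ (y '' box (fun i => N i - 1)) := hspan ▸ Submodule.mem_top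
    induction ha, hb using Submodule.span_induction₂ with
    | mem_mem a b ha hb =>
      obtain ⟨m, hm, rfl⟩ := ha
      obtain ⟨n, hn, rfl⟩ := hb
      rw [hU i m (hadd i m hm), hU i n (hadd i n hn), ← hy i m n (hadd i m hm) (hadd i n hn)]
    | zero_left b hb => simp
    | zero_right a ha => simp
    | add_left a a' b _ _ _ h1 h2 => simp only [map_add, inner_add_left, h1, h2]
    | add_right a b b' _ _ _ h1 h2 => simp only [map_add, inner_add_right, h1, h2]
    | smul_left c a b _ _ h => simp only [map_smul, inner_smul_left, h]
    | smul_right c a b _ _ h => simp only [map_smul, inner_smul_right, h]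
  have hcomm : ∀ i j, Commute (U i) (U j) := by
    intro i j
    by_cases hij : i = j
    · subst hij; exact Commute.refl _
    refine LinearMap.ext_on hspan ?_
    rintro _ ⟨m, hm, rfl⟩
    have hij' : m + Pi.single i 1 + Pi.single j 1 ∈ box N := by
      intro k
      have h1 : m k < N k - 1 := hm k
      have h2 := hr k
      by_cases hk : k = i
      · subst hk; simp [hij]; omega
      · by_cases hk' : k = j
        · subst hk'; simp [hk]; omega
        · simp [hk, hk']; omega
    simp only [Module.End.mul_apply]
    rw [hU j m (hadd j m hm), hU i m (hadd i m hm), hU j _ hij',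
      hU i _ (by rwa [add_right_comm]), add_right_comm]
  obtain ⟨ι, hι, z, v, h1, h2, h3, h4, h5⟩ :=
    exists_orthogonal_joint_eigenvectors U hiso hcomm (y 0)
  refine ⟨ι, hι, z, v, h2, h3, h4, ?_⟩
  -- `y m` is reached from `y 0` by `∑ i, m i` shifts
  suffices h : ∀ (k : ℕ) (m : Fin d → ℕ), ∑ i, m i = k → m ∈ box N →
      y m = ∑ l, (∏ i, z l i ^ m i) • v l from fun m hm => h _ m rfl hm
  intro k
  induction k with
  | zero =>
    intro m hm _
    obtain rfl : m = 0 := by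
      ext i
      simpa using (Finset.sum_eq_zero_iff.1 hm) i (Finset.mem_univ i)
    simpa using h5
  | succ k ih =>
    intro m hm hmN
    obtain ⟨i, -, hi⟩ : ∃ i ∈ Finset.univ, m i ≠ 0 := by
      by_contra! h
      rw [Finset.sum_eq_zero h] at hm
      omega
    obtain ⟨n, rfl⟩ : ∃ n : Fin d → ℕ, m = n + Pi.single i 1 := by
      refine ⟨m - Pi.single i 1, ?_⟩
      ext j
      by_cases hj : j = i
      · subst hj; simp; omega
      · simp [hj]
    rw [← hU i n hmN, ih n (by simpa [Finset.sum_add_distrib] using hm)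
      (fun j => lt_of_le_of_lt (by simp) (hmN j)), map_sum]
    refine Finset.sum_congr rfl fun l _ => ?_
    rw [map_smul, h1, smul_smul]
    congr 1
    simp only [Pi.add_apply, pow_add, Finset.prod_mul_distrib]
    congr 1
    rw [Finset.prod_eq_single i (fun j _ hj => by simp [hj]) (by simp)]
    simp

/-- Pairing a spanning shift-invariant family with suitable coefficients isolates one of its
geometric progressions. -/
theorem exists_dual_coeff {M : Fin d → ℕ} {y : (Fin d → ℕ) → E} {ι : Type} [Fintype ι]
    [DecidableEq ι] {z : ι → Fin d → ℂ} {v : ι → E} (hv : ∀ l, v l ≠ 0)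
    (ho : ∀ l k, l ≠ k → inner ℂ (v l) (v k) = 0)
    (hM : Submodule.span ℂ (y '' box M) = ⊤)
    (hy : ∀ m ∈ box M, y m = ∑ l, (∏ i, z l i ^ m i) • v l) (l : ι) :
    ∃ α : Idx M → ℂ, ∀ k, ∑ m, α m * ∏ i, z k i ^ (m i : ℕ) = if k = l then 1 else 0 := by
  have hrange : y '' box M = Set.range fun m : Idx M => y fun i => m i := by
    ext w
    constructor
    · rintro ⟨m, hm, rfl⟩; exact ⟨fun i => ⟨m i, hm i⟩, rfl⟩
    · rintro ⟨m, rfl⟩; exact ⟨_, fun i => (m i).2, rfl⟩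
  have hl : v l ∈ Submodule.span ℂ (Set.range fun m : Idx M => y fun i => m i) := by
    rw [← hrange, hM]; trivial
  obtain ⟨α, hα⟩ := (Submodule.mem_span_range_iff_exists_fun ℂ).1 hl
  refine ⟨α, fun k => ?_⟩
  have h1 : inner ℂ (v k) (v l)
      = (∑ m, α m * ∏ i, z k i ^ (m i : ℕ)) * inner ℂ (v k) (v k) := by
    rw [← hα, inner_sum, Finset.sum_mul]
    refine Finset.sum_congr rfl fun m _ => ?_
    rw [hy _ (fun i => (m i).2), inner_smul_right, inner_sum, Finset.sum_eq_single k
      (fun j _ hj => by rw [inner_smul_right, ho k j hj.symm, mul_zero]) (by simp),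
      inner_smul_right, mul_assoc]
  have h2 : inner ℂ (v k) (v k) ≠ 0 := inner_self_ne_zero.2 (hv k)
  split_ifs with hkl
  · subst hkl
    exact mul_right_cancel₀ h2 (h1.symm.trans (one_mul _).symm)
  · rw [ho k l hkl] at h1
    exact (mul_eq_zero.1 h1.symm).resolve_right h2

theorem inner_sum_smul_sum_smul {ι : Type} [Fintype ι] {v : ι → E}
    (ho : ∀ l k, l ≠ k → inner ℂ (v l) (v k) = 0) (a b : ι → ℂ) :
    inner ℂ (∑ l, a l • v l) (∑ l, b l • v l) = ∑ l, ((‖v l‖ ^ 2 : ℝ) : ℂ) * (b l * star (a l)) := by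
  rw [sum_inner]
  refine Finset.sum_congr rfl fun l _ => ?_
  rw [inner_sum, Finset.sum_eq_single l
    (fun j _ hj => by rw [inner_smul_left, inner_smul_right, ho l j hj.symm]; simp) (by simp),
    inner_smul_left, inner_smul_right, inner_self_eq_norm_sq_to_K]
  simp only [Complex.star_def, Complex.ofReal_pow, Complex.coe_algebraMap]
  ring

end ShiftInvariant

/-! ### Sinusoids, bands and superpositions of atoms -/

section Waves

/-- The value `e^{i2πkf}` at the integer `k` of the complex sinusoid of frequency `f`. -/
noncomputable def wave (k : ℤ) (f : ℝ) : ℂ :=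
  Complex.exp (2 * Real.pi * Complex.I * (k : ℂ) * (f : ℂ))

theorem wave_add (k l : ℤ) (f : ℝ) : wave (k + l) f = wave k f * wave l f := by
  simp only [wave, ← Complex.exp_add]
  congr 1
  push_cast
  ring

theorem wave_zero (f : ℝ) : wave 0 f = 1 := by simp [wave]

theorem star_wave (k : ℤ) (f : ℝ) : star (wave k f) = wave (-k) f := by
  simp only [wave]
  rw [Complex.star_def, ← Complex.exp_conj]
  congr 1
  simp [map_ofNat (starRingEnd ℂ) 2]

theorem wave_sub (k l : ℤ) (f : ℝ) : wave (k - l) f = wave k f * star (wave l f) := by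
  rw [star_wave, ← wave_add, sub_eq_add_neg]

theorem sinusoid_eq_wave (n : ℕ) (f : ℝ) (k : Fin n) : sinusoid n f k = wave (k : ℕ) f := by
  simp [sinusoid, wave]

theorem wave_natCast (m : ℕ) (f : ℝ) : wave m f = wave 1 f ^ m := by
  simp only [wave, ← Complex.exp_nat_mul]
  congr 1
  push_cast
  ring

theorem exists_wave_eq {z : ℂ} (hz : ‖z‖ = 1) : ∃ f ∈ Set.Ico (0 : ℝ) 1, wave 1 f = z := by
  obtain ⟨θ, rfl⟩ := (Complex.norm_eq_one_iff z).1 hz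
  refine ⟨Int.fract (θ / (2 * Real.pi)), ⟨Int.fract_nonneg _, Int.fract_lt_one _⟩, ?_⟩
  rw [wave, Complex.exp_eq_exp_iff_exists_int]
  refine ⟨-⌊θ / (2 * Real.pi)⌋, ?_⟩
  have hpi : (Real.pi : ℂ) ≠ 0 := by exact_mod_cast Real.pi_ne_zero
  rw [Int.fract]
  push_cast
  field_simp
  ring

theorem wave_one_injOn : Set.InjOn (wave 1) (Set.Ico 0 1) := by
  intro a ha b hb h
  rw [wave, wave, Complex.exp_eq_exp_iff_exists_int] at h
  obtain ⟨n, hn⟩ := h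
  have hpi : (Real.pi : ℂ) ≠ 0 := by exact_mod_cast Real.pi_ne_zero
  have h1 : (a : ℂ) = b + n := by
    have h2 : (2 * Real.pi * Complex.I) * (a : ℂ) = (2 * Real.pi * Complex.I) * (b + n) := by
      linear_combination hn
    exact mul_left_cancel₀ (by simp [hpi]) h2
  have h3 : a = b + n := by exact_mod_cast h1
  have h4 : n = 0 := by
    have h5 : (n : ℝ) < 1 := by linarith [ha.2, hb.1]
    have h6 : (-1 : ℝ) < n := by linarith [ha.1, hb.2]
    have h7 : n < 1 := by exact_mod_cast h5
    have h8 : -1 < n := by exact_mod_cast h6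
    omega
  simpa [h4] using h3

/-- The trigonometric polynomial `g = r_1 z⁻¹ + r_0 + r_{-1} z` of a band at `z = e^{i2πf}`, in
factored form. -/
noncomputable def bandPoly (fL fH f : ℝ) : ℝ :=
  -4 * Real.sign (fH - fL) * (Real.sin (Real.pi * (f - fL)) * Real.sin (Real.pi * (f - fH)))

theorem bandPoly_eq (fL fH f : ℝ) :
    coeff1 fL fH * wave (-1) f + coeff0 fL fH + star (coeff1 fL fH) * wave 1 f
      = (bandPoly fL fH f : ℂ) := by
  have h1 : bandPoly fL fH f = Real.sign (fH - fL) *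
      (2 * Real.cos (2 * Real.pi * f - Real.pi * (fL + fH)))
      + coeff0 fL fH := by
    rw [bandPoly, coeff0]
    have := Real.cos_sub_cos (2 * Real.pi * f - Real.pi * (fL + fH)) (Real.pi * (fH - fL))
    rw [show (2 * Real.pi * f - Real.pi * (fL + fH) + Real.pi * (fH - fL)) / 2
        = Real.pi * (f - fL) by ring,
      show (2 * Real.pi * f - Real.pi * (fL + fH) - Real.pi * (fH - fL)) / 2
        = Real.pi * (f - fH) by ring] at this
    linear_combination (-2 * Real.sign (fH - fL)) * this
  rw [h1]
  have h2 : coeff1 fL fH * wave (-1) f = Real.sign (fH - fL) *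
      Complex.exp (-((2 * Real.pi * f - Real.pi * (fL + fH) : ℝ) : ℂ) * Complex.I) := by
    rw [coeff1, wave, mul_comm _ (Real.sign (fH - fL) : ℂ), mul_assoc, ← Complex.exp_add]
    congr 2
    push_cast
    ring
  have h3 : star (coeff1 fL fH) * wave 1 f = Real.sign (fH - fL) *
      Complex.exp (((2 * Real.pi * f - Real.pi * (fL + fH) : ℝ) : ℂ) * Complex.I) := by
    rw [coeff1, wave, star_mul', Complex.star_def, ← Complex.exp_conj,
      Complex.conj_ofReal,
      mul_comm _ (Real.sign (fH - fL) : ℂ), mul_assoc, ← Complex.exp_add]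
    congr 2
    simp only [map_mul, map_add, Complex.conj_I, Complex.conj_ofReal]
    push_cast
    ring
  rw [h2, h3]
  push_cast
  rw [Complex.cos]
  ring

/-- For arguments of absolute value below `π` the sine has the sign of its argument. -/
theorem zero_le_bandPoly_iff {fL fH f : ℝ} (hL : fL ∈ Set.Ico (0 : ℝ) 1)
    (hH : fH ∈ Set.Ico (0 : ℝ) 1) (hne : fL ≠ fH) (hf : f ∈ Set.Ico (0 : ℝ) 1) :
    0 ≤ bandPoly fL fH f ↔ f ∈ band fL fH := by
  have hpos : ∀ u : ℝ, 0 < u → u < 1 → 0 < Real.sin (Real.pi * u) := fun u h0 h1 =>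
    Real.sin_pos_of_pos_of_lt_pi (by positivity) (by nlinarith [Real.pi_pos])
  have hneg : ∀ u : ℝ, u < 0 → -1 < u → Real.sin (Real.pi * u) < 0 := fun u h0 h1 => by
    have := hpos (-u) (by linarith) (by linarith)
    rw [mul_neg, Real.sin_neg] at this
    linarith
  obtain ⟨hL0, hL1⟩ := hL
  obtain ⟨hH0, hH1⟩ := hH
  obtain ⟨hf0, hf1⟩ := hf
  rcases lt_or_gt_of_ne hne with h | h
  · rw [bandPoly, band, if_pos h, Real.sign_of_pos (sub_pos.2 h), Set.mem_Icc]
    rcases lt_trichotomy f fL with h1 | h1 | h1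
    · have a := hneg (f - fL) (by linarith) (by linarith)
      have b := hneg (f - fH) (by linarith) (by linarith)
      have := mul_pos_of_neg_of_neg a b
      constructor
      · intro; linarith
      · intro h2; linarith [h2.1]
    · subst h1; simp [h.le]
    · have a := hpos (f - fL) (by linarith) (by linarith)
      rcases lt_trichotomy f fH with h2 | h2 | h2
      · have b := hneg (f - fH) (by linarith) (by linarith)
        have := mul_neg_of_pos_of_neg a b
        exact ⟨fun _ => ⟨h1.le, h2.le⟩, fun _ => by linarith⟩
      · subst h2; simp [h1.le]
      · have b := hpos (f - fH) (by linarith) (by linarith)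
        have := mul_pos a b
        constructor
        · intro; linarith
        · intro h2; linarith [h2.2]
  · rw [bandPoly, band, if_neg h.not_gt, Real.sign_of_neg (sub_neg.2 h)]
    simp only [Set.mem_sdiff, Set.mem_Ico, hf0, hf1, Set.mem_Ioo, true_and, not_and, not_lt]
    rcases lt_trichotomy f fH with h1 | h1 | h1
    · have a := hneg (f - fL) (by linarith) (by linarith)
      have b := hneg (f - fH) (by linarith) (by linarith)
      have := mul_pos_of_neg_of_neg a b
      exact ⟨fun _ h2 => by linarith, fun _ => by linarith⟩
    · subst h1; simp
    · have b := hpos (f - fH) (by linarith) (by linarith)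
      rcases lt_trichotomy f fL with h2 | h2 | h2
      · have a := hneg (f - fL) (by linarith) (by linarith)
        have := mul_neg_of_neg_of_pos a b
        exact ⟨fun h3 => by linarith, fun h3 => by linarith [h3 h1]⟩
      · subst h2; simp
      · have a := hpos (f - fL) (by linarith) (by linarith)
        have := mul_pos a b
        exact ⟨fun _ _ => h2.le, fun _ => by linarith⟩

variable {d : ℕ} {N : Fin d → ℕ}

theorem band_subset_Ico {fL fH : ℝ} (hL : fL ∈ Set.Ico (0 : ℝ) 1)
    (hH : fH ∈ Set.Ico (0 : ℝ) 1) : band fL fH ⊆ Set.Ico 0 1 := by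
  rw [band]
  split_ifs with h
  · exact fun f hf => ⟨hL.1.trans hf.1, hf.2.trans_lt hH.2⟩
  · exact Set.sdiff_subset

theorem band_infinite {fL fH : ℝ} (hL : fL ∈ Set.Ico (0 : ℝ) 1) : (band fL fH).Infinite := by
  rw [band]
  split_ifs with h
  · exact Set.Icc_infinite h
  · refine (Set.Ico_infinite hL.2).mono fun f hf => ⟨⟨hL.1.trans hf.1, hf.2⟩, fun h2 => ?_⟩
    exact absurd hf.1 h2.2.not_ge

theorem atom_mul_star_atom (f : Fin d → ℝ) (m n : Idx N) :
    atom N f m * star (atom N f n) = ∏ i, wave (lag m n i) (f i) := by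
  simp only [atom, star_prod, ← Finset.prod_mul_distrib, lag, wave_sub, sinusoid_eq_wave]

theorem abs_lag_lt (m n : Idx N) (i : Fin d) : |lag m n i| < (N i : ℤ) := by
  rw [lag, abs_lt]
  have := (m i).2
  have := (n i).2
  constructor <;> omega

/-- Every index of a tensor occurs as a lag, that is, every entry of a tensor is used in its Toeplitz
matrix. -/
theorem exists_lag_eq {k : Fin d → ℤ} (hk : ∀ i, |k i| < (N i : ℤ)) :
    ∃ m n : Idx N, lag m n = k := by
  refine ⟨fun i => ⟨(k i).toNat, ?_⟩, fun i => ⟨(-k i).toNat, ?_⟩, ?_⟩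
  · have := abs_lt.1 (hk i); have := abs_nonneg (k i); have := hk i; omega
  · have := abs_lt.1 (hk i); have := abs_nonneg (k i); have := hk i; omega
  · ext i
    simp only [lag]
    omega

/-- The tensor `∑ c_l e^{i2π⟨k, f_l⟩}`: the covariance of a superposition of atoms with powers
`c_l` and frequencies `f_l`. -/
noncomputable def spectralTensor {ι : Type} [Fintype ι] (N : Fin d → ℕ) (c : ι → ℝ)
    (f : ι → Fin d → ℝ) : Tensor N :=
  fun k => ∑ l, (c l : ℂ) * ∏ i, wave (k i) (f l i)

variable {ι : Type} [Fintype ι]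

theorem entry_spectralTensor (c : ι → ℝ) (f : ι → Fin d → ℝ) {k : Fin d → ℤ}
    (hk : ∀ i, |k i| < (N i : ℤ)) :
    (spectralTensor N c f).entry k = ∑ l, (c l : ℂ) * ∏ i, wave (k i) (f l i) := by
  rw [Tensor.entry, dif_pos hk]
  rfl

theorem toeplitz_spectralTensor (c : ι → ℝ) (f : ι → Fin d → ℝ) :
    toeplitz (spectralTensor N c f)
      = ∑ l, c l • Matrix.vecMulVec (atom N (f l)) (star (atom N (f l))) := by
  ext m n
  rw [toeplitz, Matrix.of_apply, entry_spectralTensor _ _ (abs_lag_lt m n)]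
  simp only [Matrix.sum_apply, Matrix.smul_apply, Matrix.vecMulVec_apply, Pi.star_apply,
    atom_mul_star_atom, Complex.real_smul]

/-- Passing from `T^d` to `T^d_{g_i}` weights the power of each frequency by the value of `g_i` there
and shortens the atoms. -/
theorem toeplitzG_spectralTensor (fL fH : Fin d → ℝ) (i : Fin d) (c : ι → ℝ)
    (f : ι → Fin d → ℝ) :
    toeplitzG fL fH i (spectralTensor N c f)
      = ∑ l, (c l * bandPoly (fL i) (fH i) (f l i)) •
        Matrix.vecMulVec (atom (fun j => N j - 1) (f l)) (star (atom (fun j => N j - 1) (f l))) := by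
  ext m n
  have hlag : ∀ j, |lag m n j| < (N j : ℤ) - 1 := fun j => by
    have h1 : |lag m n j| < ((N j - 1 : ℕ) : ℤ) := abs_lag_lt m n j
    have h2 : (m j : ℕ) < N j - 1 := (m j).2
    omega
  have hsub : ∀ j, |(lag m n - Pi.single i 1 : Fin d → ℤ) j| < (N j : ℤ) := fun j => by
    have h1 := abs_lt.1 (hlag j)
    rw [abs_lt]
    by_cases hj : j = i
    · subst hj; simp only [Pi.sub_apply, Pi.single_eq_same]; omega
    · simp only [Pi.sub_apply, Pi.single_eq_of_ne hj]; omega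
  have hadd : ∀ j, |(lag m n + Pi.single i 1 : Fin d → ℤ) j| < (N j : ℤ) := fun j => by
    have h1 := abs_lt.1 (hlag j)
    rw [abs_lt]
    by_cases hj : j = i
    · subst hj; simp only [Pi.add_apply, Pi.single_eq_same]; omega
    · simp only [Pi.add_apply, Pi.single_eq_of_ne hj]; omega
  have hsingle : ∀ (s : ℤ) (l : ι), ∏ j, wave ((Pi.single i s : Fin d → ℤ) j) (f l j)
      = wave s (f l i) := fun s l => by
    rw [Finset.prod_eq_single i (fun j _ hj => by rw [Pi.single_eq_of_ne hj, wave_zero]) (by simp),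
      Pi.single_eq_same]
  rw [toeplitzG, Matrix.of_apply, entry_spectralTensor _ _ hsub, entry_spectralTensor _ _ hadd,
    entry_spectralTensor _ _ (fun j => (hlag j).trans (by omega)), sub_eq_add_neg,
    ← Pi.single_neg]
  simp only [Matrix.sum_apply, Matrix.smul_apply, Matrix.vecMulVec_apply, Pi.star_apply,
    atom_mul_star_atom, Complex.real_smul, Pi.add_apply, wave_add, Finset.prod_mul_distrib,
    hsingle, Finset.mul_sum, ← Finset.sum_add_distrib]
  refine Finset.sum_congr rfl fun l _ => ?_
  rw [Complex.ofReal_mul, ← bandPoly_eq]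
  ring

theorem trace_toeplitz (B : Tensor N) :
    (toeplitz B).trace = ((∏ i, N i : ℕ) : ℂ) * B.entry 0 := by
  have : ∀ m : Idx N, lag m m = 0 := fun m => by ext i; simp [lag]
  simp [Matrix.trace, toeplitz, this]

end Waves

/-! ### Vandermonde decomposition of `d`-level Toeplitz matrices -/

section VandermondeDecomposition

variable {d : ℕ} {N : Fin d → ℕ}

/-- A positive semidefinite matrix is a Gram matrix of vectors whose span has dimension its rank. -/
theorem exists_gram_eq {n : Type} [Fintype n] {T : Matrix n n ℂ} (hT : T.PosSemidef) :
    ∃ (k : ℕ) (R : n → EuclideanSpace ℂ (Fin k)), (∀ a b, T a b = inner ℂ (R b) (R a)) ∧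
      finrank ℂ (Submodule.span ℂ (Set.range R)) = T.rank := by
  obtain ⟨k, v, rfl⟩ := Matrix.posSemidef_iff_eq_sum_vecMulVec.1 hT
  set A : Matrix n (Fin k) ℂ := Matrix.of fun a i => v i a with hA
  have hAA : ∑ i, Matrix.vecMulVec (v i) (star (v i)) = A * Aᴴ := by
    ext a b
    simp [Matrix.sum_apply, Matrix.vecMulVec_apply, Matrix.mul_apply, hA]
  refine ⟨k, fun a => WithLp.toLp 2 (A a), fun a b => ?_, ?_⟩
  · rw [hAA]
    simp [Matrix.mul_apply, PiLp.inner_apply]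
  · rw [hAA, Matrix.rank_self_mul_conjTranspose, Matrix.rank_eq_finrank_span_row,
      ← LinearEquiv.finrank_map_eq (WithLp.linearEquiv 2 ℂ (Fin k → ℂ)).symm, Submodule.map_span,
      ← Set.range_comp]
    rfl

/-- The frequencies `f` are separated at size `M` if every atom of that size has a dual vector,
orthogonal to the other atoms. -/
def Separated {ι : Type} [DecidableEq ι] (M : Fin d → ℕ) (f : ι → Fin d → ℝ) : Prop :=
  ∀ l, ∃ α : Idx M → ℂ, ∀ k, α ⬝ᵥ atom M (f k) = if k = l then 1 else 0

/-- Vandermonde decomposition of a `d`-level block Toeplitz matrix: read as a Gram matrix, it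
comes from a shift-invariant family. -/
theorem exists_eq_spectralTensor {B : Tensor N} (hB : (toeplitz B).PosSemidef)
    (hr : ∀ i, (toeplitz B).rank < N i) :
    ∃ (ι : Type) (_ : Fintype ι) (_ : DecidableEq ι) (c : ι → ℝ) (f : ι → Fin d → ℝ),
      (∀ l, 0 < c l) ∧ (∀ l i, f l i ∈ Set.Ico (0 : ℝ) 1) ∧ B = spectralTensor N c f ∧
      Separated N f ∧ Separated (fun i => N i - 1) f := by
  classical
  obtain ⟨k, R, hR, hrank⟩ := exists_gram_eq hB
  set S := Submodule.span ℂ (Set.range R)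
  set y : (Fin d → ℕ) → S := fun m =>
    if h : ∀ i, m i < N i then ⟨R fun i => ⟨m i, h i⟩, Submodule.subset_span ⟨_, rfl⟩⟩ else 0
  have hyR : ∀ m (hm : m ∈ box N), (y m : EuclideanSpace ℂ (Fin k)) = R fun i => ⟨m i, hm i⟩ :=
    fun m hm => congrArg Subtype.val (dif_pos hm)
  have hgram : ∀ m n (hm : m ∈ box N) (hn : n ∈ box N), inner ℂ (y m) (y n)
      = B.entry (fun i => (n i : ℤ) - m i) := by
    intro m n hm hn
    rw [Submodule.coe_inner, hyR m hm, hyR n hn, ← hR]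
    rfl
  have hshift : ShiftInvariant N y := by
    intro i m n hm hn
    have hle : ∀ m : Fin d → ℕ, m + Pi.single i 1 ∈ box N → m ∈ box N := fun m hm j =>
      lt_of_le_of_lt (by simp) (hm j)
    rw [hgram m n (hle m hm) (hle n hn), hgram _ _ hm hn]
    congr 1
    ext j
    simp only [Pi.add_apply]
    push_cast
    ring
  have hspan : Submodule.span ℂ (y '' box N) = ⊤ := by
    apply Submodule.map_injective_of_injective S.injective_subtype
    rw [Submodule.map_span, Submodule.map_top, Submodule.range_subtype]
    congr 1
    ext w
    constructor
    · rintro ⟨_, ⟨m, hm, rfl⟩, rfl⟩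
      exact ⟨fun i => ⟨m i, hm i⟩, (hyR m hm).symm⟩
    · rintro ⟨m, rfl⟩
      exact ⟨y fun i => m i, ⟨_, fun i => (m i).2, rfl⟩, hyR _ fun i => (m i).2⟩
  obtain ⟨ι, hι, z, v, hz, hv, ho, hsum⟩ :=
    hshift.exists_eq_sum_pow hspan (fun i => by rw [hrank]; exact hr i)
  have hspan' := hshift.span_box_sub_one hspan (fun i => by rw [hrank]; exact hr i)
  choose f hf hfz using fun l i => exists_wave_eq (hz l i)
  have hatom : ∀ (M : Fin d → ℕ) l (m : Idx M), atom M (f l) m = ∏ i, z l i ^ (m i : ℕ) := by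
    intro M l m
    simp only [atom, sinusoid_eq_wave, wave_natCast, hfz]
  have hsep : ∀ M : Fin d → ℕ, M ≤ N → Submodule.span ℂ (y '' box M) = ⊤ → Separated M f := by
    intro M hM htop l
    obtain ⟨α, hα⟩ := exists_dual_coeff hv ho htop (fun m hm => hsum m (box_mono hM hm)) l
    refine ⟨α, fun k => ?_⟩
    simp only [dotProduct, hatom, hα]
  refine ⟨ι, hι, inferInstance, fun l => ‖v l‖ ^ 2, f, fun l => by have := hv l; positivity, hf,
    ?_, hsep N le_rfl hspan, hsep _ (fun i => Nat.sub_le _ _) hspan'⟩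
  ext k
  obtain ⟨m, n, hmn⟩ := exists_lag_eq (fun i => (k i).2)
  have h1 : B k = B.entry (lag m n) := by
    rw [hmn, Tensor.entry, dif_pos fun i => (k i).2]
  have h2 : spectralTensor N (fun l => ‖v l‖ ^ 2) f k
      = (spectralTensor N (fun l => ‖v l‖ ^ 2) f).entry (lag m n) := by
    rw [hmn, Tensor.entry, dif_pos fun i => (k i).2]
  rw [h1, h2, entry_spectralTensor _ _ (abs_lag_lt m n)]
  have h3 := hgram (fun i => n i) (fun i => m i) (fun i => (n i).2) (fun i => (m i).2)
  rw [hsum _ (fun i => (n i).2), hsum _ (fun i => (m i).2)] at h3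
  refine h3.symm.trans ?_
  refine (inner_sum_smul_sum_smul ho _ _).trans ?_
  simp only [← hatom, atom_mul_star_atom]

end VandermondeDecomposition

/-! ### Decompositions into atoms of the band -/

section Decompositions

variable {d : ℕ} {N : Fin d → ℕ} {fL fH : Fin d → ℝ} {x : Idx N → ℂ}

theorem sum_norm_mem_decompositionCosts {ι : Type} [Fintype ι] {f : ι → Fin d → ℝ} {σ : ι → ℂ}
    (hf : ∀ l i, f l i ∈ band (fL i) (fH i)) (hx : x = ∑ l, σ l • atom N (f l)) :
    ∑ l, ‖σ l‖ ∈ decompositionCosts N fL fH x := by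
  set e := Fintype.equivFin ι
  refine ⟨Fintype.card ι, fun j => f (e.symm j), fun j => σ (e.symm j), fun l i => hf _ i, ?_, ?_⟩
  · rw [hx]; exact (e.symm.sum_comp fun l => σ l • atom N (f l)).symm
  · exact (e.symm.sum_comp fun l => ‖σ l‖).symm

/-- Each direction has `N_i` distinct frequencies in its band, whose Vandermonde matrix is
invertible; the products of the inverses express the standard basis by atoms. -/
theorem decompositionCosts_nonempty (hL : ∀ i, fL i ∈ Set.Ico (0 : ℝ) 1)
    (hH : ∀ i, fH i ∈ Set.Ico (0 : ℝ) 1) (x : Idx N → ℂ) :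
    (decompositionCosts N fL fH x).Nonempty := by
  classical
  set φ : ∀ i, Fin (N i) → ℝ := fun i j => (band_infinite (fH := fH i) (hL i)).natEmbedding _ j
  have hφ : ∀ i j, φ i j ∈ band (fL i) (fH i) := fun i j => Subtype.coe_prop _
  have hinj : ∀ i, Function.Injective (φ i) := fun i =>
    Subtype.val_injective.comp ((Function.Embedding.injective _).comp Fin.val_injective)
  set V : ∀ i, Matrix (Fin (N i)) (Fin (N i)) ℂ := fun i =>
    Matrix.vandermonde fun j => wave 1 (φ i j)
  have hV : ∀ i, (V i)⁻¹ * V i = 1 := fun i => by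
    refine Matrix.nonsing_inv_mul _ (isUnit_iff_ne_zero.2 ?_)
    rw [Matrix.det_vandermonde_ne_zero_iff]
    intro j k hjk
    exact hinj i (wave_one_injOn (band_subset_Ico (hL i) (hH i) (hφ i j))
      (band_subset_Ico (hL i) (hH i) (hφ i k)) hjk)
  have hsingle : ∀ k : Idx N, Pi.single k (1 : ℂ)
      = ∑ J : Idx N, (∏ i, (V i)⁻¹ (k i) (J i)) • atom N fun i => φ i (J i) := by
    intro k
    ext m
    have h1 : ∏ i, ((V i)⁻¹ * V i) (k i) (m i)
        = ∑ J : Idx N, (∏ i, (V i)⁻¹ (k i) (J i)) * atom N (fun i => φ i (J i)) m := by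
      simp only [Matrix.mul_apply, Finset.prod_univ_sum, Fintype.piFinset_univ]
      refine Finset.sum_congr rfl fun J _ => ?_
      rw [Finset.prod_mul_distrib]
      congr 1
      refine Finset.prod_congr rfl fun i _ => ?_
      rw [sinusoid_eq_wave, wave_natCast]
      rfl
    rw [Finset.sum_apply]
    refine Eq.trans ?_ h1
    simp only [hV]
    by_cases hkm : m = k
    · subst hkm; simp
    · rw [Pi.single_eq_of_ne hkm]
      obtain ⟨i, hi⟩ := Function.ne_iff.1 hkm
      have h0 : (1 : Matrix (Fin (N i)) (Fin (N i)) ℂ) (k i) (m i) = 0 :=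
        Matrix.one_apply_ne (Ne.symm hi)
      exact (Finset.prod_eq_zero (Finset.mem_univ i) h0).symm
  refine ⟨_, sum_norm_mem_decompositionCosts (ι := Idx N) (f := fun J i => φ i (J i))
    (σ := fun J => ∑ k, x k * ∏ i, (V i)⁻¹ (k i) (J i)) (fun J i => hφ _ _) ?_⟩
  calc x = ∑ k, x k • Pi.single k (1 : ℂ) := by
        ext m; simp [Pi.single_apply]
    _ = _ := by
        simp only [hsingle, Finset.smul_sum, Finset.sum_smul, smul_smul]
        exact Finset.sum_comm

theorem bddBelow_decompositionCosts : BddBelow (decompositionCosts N fL fH x) := by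
  refine ⟨0, ?_⟩
  rintro c ⟨r, f, σ, -, -, rfl⟩
  exact Finset.sum_nonneg fun l _ => norm_nonneg _

end Decompositions

/-! ### The semidefinite program -/

section Program

variable {d : ℕ} {N : Fin d → ℕ} {fL fH : Fin d → ℝ} {x : Idx N → ℂ}

theorem objective_eq (hN : ∀ i, 1 ≤ N i) (B : Tensor N) (t : ℝ) :
    objective B t = ((B.entry 0).re + t) / 2 := by
  have h : ((∏ i, N i : ℕ) : ℝ) ≠ 0 := by
    exact_mod_cast (Finset.prod_pos fun i _ => hN i).ne'
  rw [objective, trace_toeplitz, ← Complex.ofReal_natCast, Complex.re_ofReal_mul]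
  field_simp

theorem entry_zero_spectralTensor (hN : ∀ i, 1 ≤ N i) {ι : Type} [Fintype ι] (c : ι → ℝ)
    (f : ι → Fin d → ℝ) : (spectralTensor N c f).entry 0 = ((∑ l, c l : ℝ) : ℂ) := by
  rw [entry_spectralTensor c f (fun i => by simpa using Nat.lt_of_succ_le (hN i))]
  simp [wave_zero]

theorem posSemidef_sum_smul_vecMulVec {n ι : Type} [Fintype ι] [Fintype n] (c : ι → ℝ)
    (w : ι → n → ℂ) (hc : ∀ l, 0 ≤ c l) :
    (∑ l, c l • Matrix.vecMulVec (w l) (star (w l))).PosSemidef :=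
  Matrix.posSemidef_sum _ fun l _ => (Matrix.posSemidef_vecMulVec_self_star (w l)).smul (hc l)

/-- A decomposition of `x` with weights `σ` gives the feasible point whose Toeplitz matrix has the
same frequencies and the powers `|σ_l|`; its objective value is the cost of the decomposition. -/
theorem decompositionCosts_subset_sdpValues (hN : ∀ i, 1 ≤ N i)
    (hL : ∀ i, fL i ∈ Set.Ico (0 : ℝ) 1) (hH : ∀ i, fH i ∈ Set.Ico (0 : ℝ) 1)
    (hne : ∀ i, fL i ≠ fH i) : decompositionCosts N fL fH x ⊆ sdpValues N fL fH x := by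
  rintro _ ⟨r, f, σ, hf, rfl, rfl⟩
  refine ⟨spectralTensor N (fun l => ‖σ l‖) f, ∑ l, ‖σ l‖, ⟨?_, fun i => ?_⟩, ?_⟩
  · -- `u` is the phase of `σ`, and `0` where `σ` vanishes
    set u : Fin r → ℂ := fun l => σ l / ‖σ l‖
    have hu : ∀ l, (‖σ l‖ : ℂ) * u l = σ l := fun l => by
      by_cases h : σ l = 0
      · simp [u, h]
      · have : (‖σ l‖ : ℂ) ≠ 0 := by simpa using h
        simp only [u]; field_simp
    have hu' : ∀ l, (‖σ l‖ : ℂ) * (u l * star (u l)) = ‖σ l‖ := fun l => by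
      by_cases h : σ l = 0
      · simp [h]
      · have h1 : ‖u l‖ = 1 := by simp [u, h]
        rw [Complex.star_def, Complex.mul_conj, Complex.normSq_eq_norm_sq, h1]
        simp
    have : bordered (spectralTensor N (fun l => ‖σ l‖) f) (∑ l, σ l • atom N (f l)) (∑ l, ‖σ l‖)
        = ∑ l, ‖σ l‖ • Matrix.vecMulVec (Sum.elim (u l • atom N (f l)) (fun _ => (1 : ℂ)))
          (star (Sum.elim (u l • atom N (f l)) (fun _ => (1 : ℂ)))) := by
      rw [bordered, toeplitz_spectralTensor]
      ext (m | m) (n | n)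
      · simp only [Matrix.fromBlocks_apply₁₁, Matrix.sum_apply, Matrix.smul_apply,
          Matrix.vecMulVec_apply, Pi.star_apply, Sum.elim_inl, Pi.smul_apply, Complex.real_smul,
          smul_eq_mul, star_mul']
        refine Finset.sum_congr rfl fun l _ => ?_
        linear_combination (-(atom N (f l) m * star (atom N (f l) n))) * hu' l
      · simp only [Matrix.fromBlocks_apply₁₂, Matrix.sum_apply, Matrix.smul_apply,
          Matrix.vecMulVec_apply, Pi.star_apply, Sum.elim_inl, Sum.elim_inr, Pi.smul_apply,
          Complex.real_smul, smul_eq_mul, star_one, mul_one, Matrix.replicateCol_apply,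
          Finset.sum_apply, ← mul_assoc, hu]
      · simp only [Matrix.fromBlocks_apply₂₁, Matrix.sum_apply, Matrix.smul_apply,
          Matrix.vecMulVec_apply, Pi.star_apply, Sum.elim_inl, Sum.elim_inr, Pi.smul_apply,
          Complex.real_smul, smul_eq_mul, one_mul, Matrix.conjTranspose_apply,
          Matrix.replicateCol_apply, Finset.sum_apply, star_sum]
        refine Finset.sum_congr rfl fun l _ => ?_
        conv_lhs => rw [← hu l]
        simp
        ring
      · simp [Matrix.sum_apply, Matrix.vecMulVec_apply]
    rw [this]
    exact posSemidef_sum_smul_vecMulVec _ _ fun l => norm_nonneg _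
  · rw [toeplitzG_spectralTensor]
    exact posSemidef_sum_smul_vecMulVec _ _ fun l => mul_nonneg (norm_nonneg _)
      ((zero_le_bandPoly_iff (hL i) (hH i) (hne i)
        (band_subset_Ico (hL i) (hH i) (hf l i))).2 (hf l i))
  · rw [objective_eq hN, entry_zero_spectralTensor hN, Complex.ofReal_re]
    ring

theorem Feasible.posSemidef_toeplitz {B : Tensor N} {t : ℝ} (h : Feasible fL fH x B t) :
    (toeplitz B).PosSemidef :=
  h.1.submatrix Sum.inl

theorem norm_entry_le {B : Tensor N} (hB : (toeplitz B).PosSemidef)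
    (k : (i : Fin d) → {k : ℤ // |k| < (N i : ℤ)}) : ‖B k‖ ≤ (B.entry 0).re := by
  obtain ⟨r, R, hR, -⟩ := exists_gram_eq hB
  obtain ⟨m, n, hmn⟩ := exists_lag_eq (fun i => (k i).2)
  have h1 : B k = toeplitz B m n := by
    rw [toeplitz, Matrix.of_apply, hmn, Tensor.entry, dif_pos fun i => (k i).2]
  have h2 : ∀ m : Idx N, ‖R m‖ ^ 2 = (B.entry 0).re := fun m => by
    have h3 : toeplitz B m m = B.entry 0 := by
      rw [toeplitz, Matrix.of_apply]
      congr 1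
      ext i
      simp [lag]
    rw [← h3, hR, inner_self_eq_norm_sq_to_K]
    norm_cast
  rw [h1, hR]
  refine (norm_inner_le_norm _ _).trans ?_
  nlinarith [h2 m, h2 n, sq_nonneg (‖R n‖ - ‖R m‖)]

theorem isClosed_setOf_posSemidef {n : Type} [Fintype n] :
    IsClosed {A : Matrix n n ℂ | A.PosSemidef} := by
  simp only [Matrix.posSemidef_iff_dotProduct_mulVec, Matrix.IsHermitian, Set.ofPred_and,
    Set.ofPred_forall]
  refine (isClosed_eq (by fun_prop) continuous_id).inter (isClosed_iInter fun v => ?_)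
  exact isClosed_le continuous_const (by fun_prop)

theorem continuous_entry (k : Fin d → ℤ) : Continuous fun B : Tensor N => B.entry k := by
  unfold Tensor.entry
  split_ifs
  · exact continuous_apply _
  · exact continuous_const

theorem isClosed_setOf_feasible :
    IsClosed {p : Tensor N × ℝ | Feasible fL fH x p.1 p.2} := by
  have he : ∀ k : Fin d → ℤ, Continuous fun p : Tensor N × ℝ => p.1.entry k := fun k =>
    (continuous_entry k).comp continuous_fst
  simp only [Feasible, Set.ofPred_and, Set.ofPred_forall]
  refine IsClosed.inter (isClosed_setOf_posSemidef.preimage ?_)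
    (isClosed_iInter fun i => isClosed_setOf_posSemidef.preimage ?_)
  · refine Continuous.matrix_fromBlocks (continuous_matrix fun m n => he _) continuous_const
      continuous_const (continuous_matrix fun _ _ => ?_)
    exact Complex.continuous_ofReal.comp continuous_snd
  · refine continuous_matrix fun m n => ?_
    exact ((continuous_const.mul (he _)).add (continuous_const.mul (he _))).add
      (continuous_const.mul (he _))

/-- The entries of a feasible tensor are dominated by the one at lag `0`, so the sublevel sets of
the program are compact. -/
theorem exists_isLeast_sdpValues (hN : ∀ i, 1 ≤ N i) (hne : (sdpValues N fL fH x).Nonempty) :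
    ∃ v, IsLeast (sdpValues N fL fH x) v := by
  obtain ⟨_, B₀, t₀, h₀, rfl⟩ := hne
  set v₀ := objective B₀ t₀
  have hobj : Continuous fun p : Tensor N × ℝ => objective p.1 p.2 := by
    simp only [objective_eq hN]
    exact ((Complex.continuous_re.comp ((continuous_entry 0).comp continuous_fst)).add
      continuous_snd).div_const 2
  set K : Set (Tensor N × ℝ) := {p | Feasible fL fH x p.1 p.2} ∩ {p | objective p.1 p.2 ≤ v₀}
  have hKc : IsClosed K := isClosed_setOf_feasible.inter (isClosed_le hobj continuous_const)
  have hK : IsCompact K := by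
    refine IsCompact.of_isClosed_subset
      ((isCompact_univ_pi fun _ => isCompact_closedBall (0 : ℂ) (2 * v₀)).prod
        (isCompact_Icc (a := (0 : ℝ)) (b := 2 * v₀))) hKc ?_
    rintro ⟨B, t⟩ ⟨hB, hv⟩
    have hB' : Feasible fL fH x B t := hB
    have hv' : objective B t ≤ v₀ := hv
    rw [objective_eq hN] at hv'
    have ht : 0 ≤ t := by
      have := hB'.1.diag_nonneg (i := Sum.inr ())
      simpa [bordered] using this
    have h0 := norm_entry_le hB'.posSemidef_toeplitz
    have h00 : 0 ≤ (B.entry 0).re :=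
      (norm_nonneg _).trans (h0 fun i => ⟨0, by simpa using Nat.lt_of_succ_le (hN i)⟩)
    refine ⟨fun k _ => mem_closedBall_zero_iff.2 ((h0 k).trans (by linarith)), ht, ?_⟩
    change t ≤ 2 * v₀
    linarith
  obtain ⟨p, hp, hmin⟩ := hK.exists_isMinOn ⟨(B₀, t₀), h₀, le_refl v₀⟩ hobj.continuousOn
  refine ⟨objective p.1 p.2, ⟨p.1, p.2, hp.1, rfl⟩, ?_⟩
  rintro _ ⟨B, t, h, rfl⟩
  rcases le_total (objective B t) v₀ with hle | hle
  · exact hmin (show (B, t) ∈ K from ⟨h, hle⟩)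
  · exact le_trans hp.2 hle

theorem dotProduct_sum_smul_vecMulVec_mulVec_star {n ι : Type} [Fintype ι] [Fintype n]
    (c : ι → ℝ) (w : ι → n → ℂ) (β : n → ℂ) :
    β ⬝ᵥ ((∑ l, c l • Matrix.vecMulVec (w l) (star (w l))) *ᵥ star β)
      = ((∑ l, c l * ‖β ⬝ᵥ w l‖ ^ 2 : ℝ) : ℂ) := by
  rw [Matrix.sum_mulVec, dotProduct_sum, Complex.ofReal_sum]
  refine Finset.sum_congr rfl fun l _ => ?_
  rw [Matrix.smul_mulVec, dotProduct_smul, Matrix.vecMulVec_mulVec, Complex.real_smul,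
    dotProduct_smul, Matrix.star_dotProduct_star, op_smul_eq_smul, smul_eq_mul,
    mul_comm (star _),
    Complex.star_def, Complex.mul_conj, Complex.normSq_eq_norm_sq, Complex.ofReal_mul]

/-- The bordered matrix tested against the vector `(star β, -1)`. -/
theorem two_mul_re_dotProduct_le {ι : Type} [Fintype ι] {c : ι → ℝ} {f : ι → Fin d → ℝ} {t : ℝ}
    (h : (bordered (spectralTensor N c f) x t).PosSemidef) (β : Idx N → ℂ) :
    2 * (β ⬝ᵥ x).re ≤ ∑ l, c l * ‖β ⬝ᵥ atom N (f l)‖ ^ 2 + t := by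
  have h1 := h.dotProduct_mulVec_nonneg (Sum.elim (star β) fun _ => -1)
  have h2 : star (Sum.elim (star β) fun _ : Unit => (-1 : ℂ)) = Sum.elim β fun _ => -1 := by
    ext (i | i) <;> simp
  have h3 : (Matrix.replicateCol Unit x)ᴴ *ᵥ star β = fun _ => star (β ⬝ᵥ x) := by
    ext i
    simp [Matrix.mulVec, dotProduct, mul_comm]
  have h4 : Matrix.replicateCol Unit x *ᵥ (fun _ => (-1 : ℂ)) = -x := by
    ext i
    simp [Matrix.mulVec, dotProduct]
  rw [h2, bordered, Matrix.fromBlocks_mulVec, Sum.elim_comp_inl, Sum.elim_comp_inr,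
    sumElim_dotProduct_sumElim, toeplitz_spectralTensor, dotProduct_add,
    dotProduct_sum_smul_vecMulVec_mulVec_star, h3, h4] at h1
  have h5 : ∀ s : ℂ, (fun _ : Unit => (-1 : ℂ)) ⬝ᵥ
      ((fun _ => s) + (Matrix.of fun _ _ : Unit => (t : ℂ)) *ᵥ fun _ => -1) = -s + t := fun s => by
    simp [Matrix.mulVec, dotProduct]
    ring
  have h6 := (Complex.le_def.1 h1).1
  rw [h5, dotProduct_neg] at h6
  simp only [Complex.zero_re, Complex.add_re, Complex.neg_re, Complex.ofReal_re, Complex.star_def,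
    Complex.conj_re] at h6
  linarith

/-- If the Toeplitz matrix of a feasible point has small rank, its frequencies and the coefficients
of `x` along them form an admissible decomposition, no more costly than the objective. -/
theorem Feasible.exists_cost_le (hN : ∀ i, 1 ≤ N i)
    (hL : ∀ i, fL i ∈ Set.Ico (0 : ℝ) 1) (hH : ∀ i, fH i ∈ Set.Ico (0 : ℝ) 1)
    (hne : ∀ i, fL i ≠ fH i) {B : Tensor N} {t : ℝ} (h : Feasible fL fH x B t)
    (hr : ∀ i, (toeplitz B).rank < N i) :
    ∃ c ∈ decompositionCosts N fL fH x, c ≤ objective B t := by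
  obtain ⟨ι, hι, hdec, c, f, hc, hf, rfl, hsep, hsep'⟩ :=
    exists_eq_spectralTensor h.posSemidef_toeplitz hr
  have hband : ∀ l i, f l i ∈ band (fL i) (fH i) := by
    intro l i
    rw [← zero_le_bandPoly_iff (hL i) (hH i) (hne i) (hf l i)]
    obtain ⟨α, hα⟩ := hsep' l
    have h1 := (h.2 i).dotProduct_mulVec_nonneg (star α)
    rw [toeplitzG_spectralTensor, star_star, dotProduct_sum_smul_vecMulVec_mulVec_star,
      Complex.zero_le_real] at h1
    have h2 : 0 ≤ c l * bandPoly (fL i) (fH i) (f l i) := by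
      rw [Finset.sum_eq_single l (fun k _ hk => by simp [hα, hk]) (by simp)] at h1
      simpa [hα] using h1
    exact nonneg_of_mul_nonneg_right h2 (hc l)
  choose α hα using hsep
  have hineq := two_mul_re_dotProduct_le h.1
  -- functionals vanishing on all atoms vanish at `x`
  have hker : ∀ β : Idx N → ℂ, (∀ l, β ⬝ᵥ atom N (f l) = 0) → β ⬝ᵥ x = 0 := by
    intro β hβ
    by_contra h0
    have hpos : 0 < ‖β ⬝ᵥ x‖ ^ 2 := by positivity
    -- the left side of the inequality at this multiple of `β` is `2 (t + 1)`, its right side `t`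
    have h1 := hineq (((((t + 1) / ‖β ⬝ᵥ x‖ ^ 2 : ℝ) : ℂ) * star (β ⬝ᵥ x)) • β)
    simp only [smul_dotProduct, hβ, smul_eq_mul, mul_zero, norm_zero] at h1
    rw [mul_assoc, mul_comm (star _), Complex.star_def, Complex.mul_conj,
      Complex.normSq_eq_norm_sq, ← Complex.ofReal_mul, Complex.ofReal_re,
      div_mul_cancel₀ _ hpos.ne'] at h1
    have h2 := hineq 0
    simp at h1 h2
    linarith
  set σ : ι → ℂ := fun l => α l ⬝ᵥ x with hσ
  have hsum : ∀ (a : ι → ℂ) k, (∑ l, a l • α l) ⬝ᵥ atom N (f k) = a k := by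
    intro a k
    simp [sum_dotProduct, hα]
  have hx : x = ∑ l, σ l • atom N (f l) := by
    set p := x - ∑ l, σ l • atom N (f l) with hp
    have hαp : ∀ l, α l ⬝ᵥ p = 0 := fun l => by
      simp [hp, dotProduct_sub, dotProduct_sum, hα, hσ]
    -- `star p`, corrected by the dual vectors so as to vanish on the atoms
    set β := star p - ∑ l, (star p ⬝ᵥ atom N (f l)) • α l
    have hβ : ∀ l, β ⬝ᵥ atom N (f l) = 0 := fun l => by
      simp only [β, sub_dotProduct, hsum, sub_self]
    have h1 : β ⬝ᵥ p = 0 := by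
      simp [hp, dotProduct_sub, dotProduct_sum, hβ, hker β hβ]
    have h2 : star p ⬝ᵥ p = 0 := by
      simpa [β, sub_dotProduct, sum_dotProduct, hαp] using h1
    exact sub_eq_zero.1 (dotProduct_star_self_eq_zero.1 h2)
  refine ⟨_, sum_norm_mem_decompositionCosts hband hx, ?_⟩
  -- this test vector pairs with `x` to `∑ |σ_l|`, and with each atom to a phase (or `0`)
  have h1 := hineq (∑ l, (star (σ l) / ‖σ l‖) • α l)
  have h2 : (∑ l, (star (σ l) / ‖σ l‖) • α l) ⬝ᵥ x = ((∑ l, ‖σ l‖ : ℝ) : ℂ) := by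
    rw [sum_dotProduct, Complex.ofReal_sum]
    refine Finset.sum_congr rfl fun l _ => ?_
    rw [smul_dotProduct, smul_eq_mul, div_mul_eq_mul_div, mul_comm, Complex.star_def,
      Complex.mul_conj, Complex.normSq_eq_norm_sq]
    by_cases h0 : σ l = 0
    · simp [h0]
    · have : (‖σ l‖ : ℂ) ≠ 0 := by simpa using h0
      rw [show α l ⬝ᵥ x = σ l from rfl]
      push_cast
      field_simp
  have h3 : ∑ l, c l * ‖star (σ l) / (‖σ l‖ : ℂ)‖ ^ 2 ≤ ∑ l, c l := by
    refine Finset.sum_le_sum fun l _ =>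
      mul_le_of_le_one_right (hc l).le (pow_le_one₀ (norm_nonneg _) ?_)
    rw [norm_div, norm_star, Complex.norm_real, norm_norm]
    exact div_self_le_one _
  simp only [hsum] at h1
  rw [h2, Complex.ofReal_re] at h1
  rw [objective_eq hN, entry_zero_spectralTensor hN, Complex.ofReal_re]
  linarith

end Program

end MDFS

theorem theorem3 {d : ℕ} (hd : 1 ≤ d) (N : Fin d → ℕ) (hN : ∀ i, 1 ≤ N i)
    (fL fH : Fin d → ℝ)
    (hL : ∀ i, fL i ∈ Set.Ico (0 : ℝ) 1) (hH : ∀ i, fH i ∈ Set.Ico (0 : ℝ) 1)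
    (hne : ∀ i, fL i ≠ fH i) (x : MDFS.Idx N → ℂ) :
    (MDFS.decompositionCosts N fL fH x).Nonempty ∧
    ∃ v : ℝ, IsLeast (MDFS.sdpValues N fL fH x) v ∧
      v ≤ MDFS.atomicNorm N fL fH x ∧
      ∀ (B : MDFS.Tensor N) (t : ℝ), MDFS.Feasible fL fH x B t → MDFS.objective B t = v →
        (MDFS.toeplitz B).rank < ⨅ i, N i →
        MDFS.atomicNorm N fL fH x = v := by
  have hcost := MDFS.decompositionCosts_nonempty hL hH x
  have hsub := MDFS.decompositionCosts_subset_sdpValues (x := x) hN hL hH hne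
  obtain ⟨v, hv⟩ := MDFS.exists_isLeast_sdpValues hN (hcost.mono hsub)
  have hle : v ≤ MDFS.atomicNorm N fL fH x := le_csInf hcost fun c hc => hv.2 (hsub hc)
  refine ⟨hcost, v, hv, hle, fun B t hB hBv hr => le_antisymm ?_ hle⟩
  obtain ⟨c, hc, hcle⟩ := hB.exists_cost_le hN hL hH hne
    (fun i => hr.trans_le (ciInf_le (OrderBot.bddBelow _) i))
  exact (csInf_le MDFS.bddBelow_decompositionCosts hc).trans (hcle.trans hBv.le)
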